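/- Let $X_n$, $n\ge 1$, be real random variables on a probability space and $S_n=X_1+\cdots+X_n$. The sequence is called L-weakly dependent if there are coefficients $\gamma_k\ge 0$, $k\ge 1$, with $\sum_{k\ge1}\gamma_k<\infty$, such that for all disjoint finite sets $I,J\subset\{1,2,\dots\}$ and all Lipschitz functions $f:\mathbb{R}^I\to\mathbb{R}$, $g:\mathbb{R}^J\to\mathbb{R}$, $$\bigl|\mathrm{Cov}\bigl(f(X_i,i\in I),\,g(X_j,j\in J)\bigr)\bigr|\le \|f\|\,\|g\|\sum_{i\in I}\sum_{j\in J}\gamma_{|j-i|},\qquad \|f\|=\sup_{x\ne y}\frac{|f(x)-f(y)|}{\sum_{i}|x_i-y_i|}.$$ **Theorem (central limit theorem).** Let $X_n$, $n\ge1$, be centered, square integrable, strictly stationary and L-weakly dependent. Then the limit $\sigma^2=\lim_{n\to\infty}\frac1n\,\mathbb{E}\,S_n^2$ exists in $[0,\infty)$, and $\frac{1}{\sqrt n}S_n$ converges in distribution to $N(0,\sigma^2)$, the centered normal distribution with variance $\sigma^2$ (where $N(0,0)$ is the point mass at $0$). -/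

import Mathlib

open MeasureTheory ProbabilityTheory Filter
open scoped Topology NNReal

noncomputable section

/-- `f` is a Lipschitz function of finitely many real variables
(with respect to the `ℓ¹` norm `∑ i, |x i|`, hence with respect to any norm). -/
def IsLip {ι : Type*} [Fintype ι] (f : (ι → ℝ) → ℝ) : Prop :=
  ∃ K : ℝ, ∀ x y : ι → ℝ, |f x - f y| ≤ K * ∑ i, |x i - y i|

/-- The Lipschitz norm `‖f‖ = sup_{x ≠ y} |f x - f y| / |x - y|`, where `|x - y| = ∑ i, |x i - y i|`.
With this norm on the argument, `x ↦ cos (∑ i, t i * x i)` has Lipschitz norm `max_i |t i|`.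
(The supremum over the empty set, which occurs when there is no variable, is `0`.) -/
def lipNorm {ι : Type*} [Fintype ι] (f : (ι → ℝ) → ℝ) : ℝ :=
  sSup {r : ℝ | ∃ x y : ι → ℝ, x ≠ y ∧ r = |f x - f y| / ∑ i, |x i - y i|}

/-- L-weak dependence of a sequence of real random variables: there is one sequence of nonnegative
coefficients with convergent sum which controls the covariances of Lipschitz functions of any two
disjoint finite subfamilies. As `I` and `J` are disjoint, only the `γ k` with `k ≥ 1` occur
in the inequality. -/
def IsLWeaklyDependent {Ω : Type*} [MeasurableSpace Ω] (μ : Measure Ω) (X : ℕ → Ω → ℝ) : Prop :=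
  ∃ γ : ℕ → ℝ, (∀ k, 0 ≤ γ k) ∧ Summable γ ∧
    ∀ I J : Finset ℕ, Disjoint I J →
      ∀ (f : (I → ℝ) → ℝ) (g : (J → ℝ) → ℝ), IsLip f → IsLip g →
        |cov[fun ω ↦ f (fun i ↦ X i ω), fun ω ↦ g (fun j ↦ X j ω); μ]| ≤
          lipNorm f * lipNorm g * ∑ i ∈ I, ∑ j ∈ J, γ ((j : ℤ) - (i : ℤ)).natAbs

/-- Strict stationarity: the finite-dimensional distributions are invariant under time shifts. -/
def IsStrictlyStationary {Ω : Type*} [MeasurableSpace Ω] (μ : Measure Ω) (X : ℕ → Ω → ℝ) : Prop :=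
  ∀ (h : ℕ) (I : Finset ℕ),
    IdentDistrib (fun ω (i : I) ↦ X (i + h) ω) (fun ω (i : I) ↦ X i ω) μ μ

/-- `partialSum X n` is the sum of the first `n` terms of the sequence,
which is indexed from `0`: `X 0` is the first term. -/
def partialSum {Ω : Type*} (X : ℕ → Ω → ℝ) (n : ℕ) (ω : Ω) : ℝ :=
  ∑ k ∈ Finset.range n, X k ω

end

/-! The proof uses characteristic functions and adjacent blocks of a fixed length `m`, with no gaps.
Since `cos` and `sin` are 1-Lipschitz, weak dependence nearly factorises the characteristic function
of a sum over two disjoint blocks (`IsCovarianceBound.norm_integral_cexp_sub_le`). Splitting off one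
block costs at most `4 * s ^ 2` times a sum of `m` tails of `∑ γ`, however long the past is. At `s =
t / √n` the `n / m` blocks cost at most `4 * t ^ 2 * ε m`, where `ε m` is a Cesàro mean of tails and
tends to `0`.

For fixed `m`, the power `n / m` of the characteristic function of one block converges as for
independent blocks (`tendsto_charFun_pow_div`), and the `n % m` leftover terms are negligible in
`L¹`. Letting `m` grow then replaces `E S_m² / m` by its limit. -/

/-- `γ` bounds the covariances of Lipschitz functions of disjoint finite subfamilies of `X`. -/
def IsCovarianceBound {Ω : Type*} [MeasurableSpace Ω] (μ : Measure Ω) (X : ℕ → Ω → ℝ)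
    (γ : ℕ → ℝ) : Prop :=
  ∀ I J : Finset ℕ, Disjoint I J →
    ∀ (f : (I → ℝ) → ℝ) (g : (J → ℝ) → ℝ), IsLip f → IsLip g →
      |cov[fun ω ↦ f (fun i ↦ X i ω), fun ω ↦ g (fun j ↦ X j ω); μ]| ≤
        lipNorm f * lipNorm g * ∑ i ∈ I, ∑ j ∈ J, γ ((j : ℤ) - (i : ℤ)).natAbs

theorem lipNorm_nonneg {ι : Type*} [Fintype ι] (f : (ι → ℝ) → ℝ) : 0 ≤ lipNorm f := by
  refine Real.sSup_nonneg ?_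
  rintro r ⟨x, y, -, rfl⟩
  positivity

theorem lipNorm_le {ι : Type*} [Fintype ι] {f : (ι → ℝ) → ℝ} {K : ℝ} (hK : 0 ≤ K)
    (hf : ∀ x y : ι → ℝ, |f x - f y| ≤ K * ∑ i, |x i - y i|) : lipNorm f ≤ K := by
  refine Real.sSup_le ?_ hK
  rintro r ⟨x, y, -, rfl⟩
  exact div_le_of_le_mul₀ (by positivity) hK (hf x y)

theorem abs_comp_mul_sum_sub_le {ι : Type*} [Fintype ι] {u : ℝ → ℝ}
    (hu : ∀ a b, |u a - u b| ≤ |a - b|) (s : ℝ) (x y : ι → ℝ) :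
    |u (s * ∑ i, x i) - u (s * ∑ i, y i)| ≤ |s| * ∑ i, |x i - y i| := by
  refine (hu _ _).trans ?_
  rw [← mul_sub, ← Finset.sum_sub_distrib, abs_mul]
  gcongr
  exact Finset.abs_sum_le_sum_abs _ _

section

variable {Ω : Type*} [MeasurableSpace Ω] {μ : Measure Ω} {X : ℕ → Ω → ℝ} {γ : ℕ → ℝ}

theorem IsCovarianceBound.abs_cov_comp_sum_le (hγ : IsCovarianceBound μ X γ) (hγ0 : ∀ k, 0 ≤ γ k)
    {I J : Finset ℕ} (hIJ : Disjoint I J) {u v : ℝ → ℝ}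
    (hu : ∀ a b, |u a - u b| ≤ |a - b|) (hv : ∀ a b, |v a - v b| ≤ |a - b|) (s : ℝ) :
    |cov[fun ω ↦ u (s * ∑ i ∈ I, X i ω), fun ω ↦ v (s * ∑ j ∈ J, X j ω); μ]| ≤
      s ^ 2 * ∑ i ∈ I, ∑ j ∈ J, γ ((j : ℤ) - (i : ℤ)).natAbs := by
  have hf := abs_comp_mul_sum_sub_le (ι := I) hu s
  have hg := abs_comp_mul_sum_sub_le (ι := J) hv s
  have h := hγ I J hIJ (fun x ↦ u (s * ∑ i, x i)) (fun x ↦ v (s * ∑ i, x i)) ⟨_, hf⟩ ⟨_, hg⟩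
  have e : ∀ (K : Finset ℕ) (ω : Ω), ∑ i : K, X i ω = ∑ i ∈ K, X i ω :=
    fun K ω ↦ Finset.sum_coe_sort K fun i ↦ X i ω
  simp only [e] at h
  refine h.trans ?_
  rw [← sq_abs s, sq]
  have h0 : 0 ≤ ∑ i ∈ I, ∑ j ∈ J, γ ((j : ℤ) - (i : ℤ)).natAbs :=
    Finset.sum_nonneg fun _ _ ↦ Finset.sum_nonneg fun _ _ ↦ hγ0 _
  gcongr
  · exact lipNorm_nonneg _
  · exact lipNorm_le (abs_nonneg s) hf
  · exact lipNorm_le (abs_nonneg s) hg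

/-! ### Approximate factorisation of characteristic functions -/

theorem memLp_cos [IsProbabilityMeasure μ] {U : Ω → ℝ} (hU : AEMeasurable U μ) :
    MemLp (fun ω ↦ Real.cos (U ω)) 2 μ :=
  MemLp.of_bound (Real.measurable_cos.comp_aemeasurable hU).aestronglyMeasurable 1
    (.of_forall fun _ ↦ Real.abs_cos_le_one _)

theorem memLp_sin [IsProbabilityMeasure μ] {U : Ω → ℝ} (hU : AEMeasurable U μ) :
    MemLp (fun ω ↦ Real.sin (U ω)) 2 μ :=
  MemLp.of_bound (Real.measurable_sin.comp_aemeasurable hU).aestronglyMeasurable 1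
    (.of_forall fun _ ↦ Real.abs_sin_le_one _)

theorem integral_cexp_eq [IsProbabilityMeasure μ] {U : Ω → ℝ} (hU : AEMeasurable U μ) :
    ∫ ω, Complex.exp (U ω * Complex.I) ∂μ =
      ((∫ ω, Real.cos (U ω) ∂μ : ℝ) : ℂ) + ((∫ ω, Real.sin (U ω) ∂μ : ℝ) : ℂ) * Complex.I := by
  have hc := (memLp_cos hU).integrable one_le_two
  have hs := (memLp_sin hU).integrable one_le_two
  rw [← integral_complex_ofReal, ← integral_complex_ofReal, ← integral_mul_const,
    ← integral_add hc.ofReal (hs.ofReal.mul_const _)]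
  simp [Complex.exp_mul_I]

theorem integral_cexp_add_sub [IsProbabilityMeasure μ] {U V : Ω → ℝ} (hU : AEMeasurable U μ)
    (hV : AEMeasurable V μ) :
    ∫ ω, Complex.exp ((U ω + V ω : ℝ) * Complex.I) ∂μ -
        (∫ ω, Complex.exp (U ω * Complex.I) ∂μ) * ∫ ω, Complex.exp (V ω * Complex.I) ∂μ =
      (cov[fun ω ↦ Real.cos (U ω), fun ω ↦ Real.cos (V ω); μ] : ℂ)
        - cov[fun ω ↦ Real.sin (U ω), fun ω ↦ Real.sin (V ω); μ]
        + (cov[fun ω ↦ Real.cos (U ω), fun ω ↦ Real.sin (V ω); μ]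
        + cov[fun ω ↦ Real.sin (U ω), fun ω ↦ Real.cos (V ω); μ]) * Complex.I := by
  have cU := memLp_cos hU
  have sU := memLp_sin hU
  have cV := memLp_cos hV
  have sV := memLp_sin hV
  rw [integral_cexp_eq (U := fun ω ↦ U ω + V ω) (hU.add hV), integral_cexp_eq hU, integral_cexp_eq hV,
    covariance_eq_sub cU cV, covariance_eq_sub sU sV, covariance_eq_sub cU sV,
    covariance_eq_sub sU cV]
  simp only [Real.cos_add, Real.sin_add, Pi.mul_apply]
  have e1 := integral_sub (cU.integrable_mul cV) (sU.integrable_mul sV)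
  have e2 := integral_add (sU.integrable_mul cV) (cU.integrable_mul sV)
  simp only [Pi.mul_apply] at e1 e2
  rw [e1, e2]
  push_cast
  linear_combination (-(∫ ω, Real.sin (U ω) ∂μ : ℝ) * (∫ ω, Real.sin (V ω) ∂μ : ℝ) : ℂ) *
    Complex.I_sq

/-- The factor `4` counts the covariances between the cosines and sines of the two sums. -/
theorem IsCovarianceBound.norm_integral_cexp_sub_le [IsProbabilityMeasure μ]
    (hγ : IsCovarianceBound μ X γ) (hγ0 : ∀ k, 0 ≤ γ k) (hX : ∀ n, AEMeasurable (X n) μ)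
    {I J : Finset ℕ} (hIJ : Disjoint I J) (s : ℝ) :
    ‖∫ ω, Complex.exp ((s * ∑ i ∈ I, X i ω + s * ∑ j ∈ J, X j ω : ℝ) * Complex.I) ∂μ -
      (∫ ω, Complex.exp ((s * ∑ i ∈ I, X i ω : ℝ) * Complex.I) ∂μ) *
        ∫ ω, Complex.exp ((s * ∑ j ∈ J, X j ω : ℝ) * Complex.I) ∂μ‖ ≤
      4 * (s ^ 2 * ∑ i ∈ I, ∑ j ∈ J, γ ((j : ℤ) - (i : ℤ)).natAbs) := by
  have hm : ∀ K : Finset ℕ, AEMeasurable (fun ω ↦ s * ∑ i ∈ K, X i ω) μ := fun K ↦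
    (Finset.aemeasurable_fun_sum _ fun i _ ↦ hX i).const_mul s
  rw [integral_cexp_add_sub (hm I) (hm J)]
  have hc : ∀ a b, |Real.cos a - Real.cos b| ≤ |a - b| := fun a b ↦ by
    simpa [Real.dist_eq] using Real.lipschitzWith_cos.dist_le_mul a b
  have hs : ∀ a b, |Real.sin a - Real.sin b| ≤ |a - b| := fun a b ↦ by
    simpa [Real.dist_eq] using Real.lipschitzWith_sin.dist_le_mul a b
  have h1 := hγ.abs_cov_comp_sum_le hγ0 hIJ hc hc s
  have h2 := hγ.abs_cov_comp_sum_le hγ0 hIJ hs hs s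
  have h3 := hγ.abs_cov_comp_sum_le hγ0 hIJ hc hs s
  have h4 := hγ.abs_cov_comp_sum_le hγ0 hIJ hs hc s
  refine (norm_add_le _ _).trans ?_
  rw [norm_mul, Complex.norm_I, mul_one]
  refine (add_le_add (norm_sub_le _ _) (norm_add_le _ _)).trans ?_
  simp only [Complex.norm_real, Real.norm_eq_abs]
  linarith

/-! ### Splitting a partial sum into adjacent blocks -/

theorem sum_range_natAbs_le_tsum (hγ0 : ∀ k, 0 ≤ γ k) (hs : Summable γ) (N j : ℕ) :
    ∑ i ∈ Finset.range N, γ (((N + j : ℕ) : ℤ) - (i : ℤ)).natAbs ≤ ∑' k, γ (k + (j + 1)) := by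
  -- Counted backwards from `N - 1`, the `i`-th index lies at distance `i + (j + 1)` from `N + j`.
  rw [← Finset.sum_range_reflect]
  refine le_trans (le_of_eq (Finset.sum_congr rfl fun i hi ↦ ?_))
    (((summable_nat_add_iff (j + 1)).2 hs).sum_le_tsum (Finset.range N) fun _ _ ↦ hγ0 _)
  have := Finset.mem_range.1 hi
  congr 1
  omega

/-- The bound does not depend on `N`: the `j`-th point of the block meets the past at distinct
distances, all at least `j + 1`. -/
theorem sum_block_le (hγ0 : ∀ k, 0 ≤ γ k) (hs : Summable γ) (N m : ℕ) :
    ∑ i ∈ Finset.range N, ∑ j ∈ Finset.Ico N (N + m), γ ((j : ℤ) - (i : ℤ)).natAbs ≤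
      ∑ j ∈ Finset.range m, ∑' k, γ (k + (j + 1)) := by
  rw [Finset.sum_comm, Finset.sum_Ico_eq_sum_range, Nat.add_sub_cancel_left]
  exact Finset.sum_le_sum fun j _ ↦ sum_range_natAbs_le_tsum hγ0 hs N j

theorem IsStrictlyStationary.identDistrib_sum_Ico (h : IsStrictlyStationary μ X) (N m : ℕ) :
    IdentDistrib (fun ω ↦ ∑ j ∈ Finset.Ico N (N + m), X j ω) (partialSum X m) μ μ := by
  have := (h N (Finset.range m)).comp (u := fun x ↦ ∑ i, x i) (by fun_prop)
  convert this using 1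
  · ext ω
    rw [Finset.sum_Ico_eq_sum_range, Nat.add_sub_cancel_left]
    simp only [Function.comp_apply]
    rw [Finset.sum_coe_sort (Finset.range m) fun i ↦ X (i + N) ω]
    simp_rw [add_comm]
  · ext ω
    exact (Finset.sum_coe_sort (Finset.range m) fun i ↦ X i ω).symm

theorem norm_integral_cexp_le_one [IsProbabilityMeasure μ] (U : Ω → ℝ) :
    ‖∫ ω, Complex.exp (U ω * Complex.I) ∂μ‖ ≤ 1 := by
  refine (norm_integral_le_integral_norm _).trans ?_
  simp [Complex.norm_exp_ofReal_mul_I]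

theorem norm_integral_cexp_partialSum_sub_pow_le [IsProbabilityMeasure μ]
    (hγ : IsCovarianceBound μ X γ) (hγ0 : ∀ k, 0 ≤ γ k) (hs : Summable γ)
    (hX : ∀ n, AEMeasurable (X n) μ) (hstat : IsStrictlyStationary μ X) (s : ℝ) (m k : ℕ) :
    ‖∫ ω, Complex.exp ((s * partialSum X (k * m) ω : ℝ) * Complex.I) ∂μ -
      (∫ ω, Complex.exp ((s * partialSum X m ω : ℝ) * Complex.I) ∂μ) ^ k‖ ≤
      k * (4 * (s ^ 2 * ∑ j ∈ Finset.range m, ∑' k, γ (k + (j + 1)))) := by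
  induction k with
  | zero => simp [partialSum]
  | succ k ih =>
    set C := 4 * (s ^ 2 * ∑ j ∈ Finset.range m, ∑' k, γ (k + (j + 1)))
    set φ := ∫ ω, Complex.exp ((s * partialSum X m ω : ℝ) * Complex.I) ∂μ with hφ
    set A := ∫ ω, Complex.exp ((s * partialSum X (k * m) ω : ℝ) * Complex.I) ∂μ with hA
    have hd : Disjoint (Finset.range (k * m)) (Finset.Ico (k * m) (k * m + m)) := by
      rw [Finset.range_eq_Ico]
      exact Finset.Ico_disjoint_Ico_consecutive _ _ _
    have h := hγ.norm_integral_cexp_sub_le hγ0 hX hd s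
    have hB : ∫ ω, Complex.exp
        ((s * ∑ j ∈ Finset.Ico (k * m) (k * m + m), X j ω : ℝ) * Complex.I) ∂μ = φ :=
      ((hstat.identDistrib_sum_Ico (k * m) m).comp
        (u := fun x : ℝ ↦ Complex.exp ((s * x : ℝ) * Complex.I)) (by fun_prop)).integral_eq
    rw [hB] at h
    have hsum : ∀ ω, s * ∑ i ∈ Finset.range (k * m), X i ω +
        s * ∑ j ∈ Finset.Ico (k * m) (k * m + m), X j ω = s * partialSum X ((k + 1) * m) ω := by
      intro ω
      rw [← mul_add, Finset.sum_range_add_sum_Ico _ (Nat.le_add_right _ _), partialSum, add_mul,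
        one_mul]
    simp_rw [hsum] at h
    have h' := h.trans (mul_le_mul_of_nonneg_left
      (mul_le_mul_of_nonneg_left (sum_block_le hγ0 hs _ _) (sq_nonneg s)) (by norm_num))
    change ‖_ - A * φ‖ ≤ C at h'
    have hφ1 : ‖φ‖ ≤ 1 := norm_integral_cexp_le_one _
    -- As `‖φ‖ ≤ 1`, earlier errors are not amplified and the total grows linearly in `k`.
    have h2 : ‖(A - φ ^ k) * φ‖ ≤ k * C := by
      rw [norm_mul]
      exact (mul_le_of_le_one_right (norm_nonneg _) hφ1).trans ih
    refine (norm_sub_le_norm_sub_add_norm_sub _ (A * φ) _).trans ?_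
    rw [pow_succ, ← sub_mul, Nat.cast_succ]
    linarith

/-! ### The limiting variance -/

theorem memLp_partialSum (hX : ∀ n, MemLp (X n) 2 μ) (n : ℕ) : MemLp (partialSum X n) 2 μ :=
  memLp_finsetSum _ fun i _ ↦ hX i

theorem IsStrictlyStationary.integral_mul_eq (h : IsStrictlyStationary μ X) (i k : ℕ) :
    ∫ ω, X i ω * X (k + i) ω ∂μ = ∫ ω, X 0 ω * X k ω ∂μ := by
  have := ((h i {0, k}).comp
    (u := fun x : ({0, k} : Finset ℕ) → ℝ ↦ x ⟨0, by simp⟩ * x ⟨k, by simp⟩) (by fun_prop)).integral_eq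
  simpa [Function.comp_def] using this

theorem IsCovarianceBound.abs_integral_mul_le [IsProbabilityMeasure μ]
    (hγ : IsCovarianceBound μ X γ) (hγ0 : ∀ k, 0 ≤ γ k) (hX : ∀ n, MemLp (X n) 2 μ)
    (hcent : ∀ n, ∫ ω, X n ω ∂μ = 0) (k : ℕ) :
    |∫ ω, X 0 ω * X (k + 1) ω ∂μ| ≤ γ (k + 1) := by
  have h := hγ.abs_cov_comp_sum_le hγ0 (I := {0}) (J := {k + 1}) (by simp) (u := id) (v := id)
    (fun _ _ ↦ le_rfl) (fun _ _ ↦ le_rfl) 1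
  simp only [id, one_mul, Finset.sum_singleton, one_pow] at h
  rw [covariance_eq_sub (hX 0) (hX _), hcent, zero_mul, sub_zero] at h
  exact h

theorem integral_partialSum_succ_sq (hX : ∀ n, MemLp (X n) 2 μ)
    (hstat : IsStrictlyStationary μ X) (n : ℕ) :
    ∫ ω, partialSum X (n + 1) ω ^ 2 ∂μ = ∫ ω, partialSum X n ω ^ 2 ∂μ +
      (∫ ω, X 0 ω * X 0 ω ∂μ + 2 * ∑ i ∈ Finset.range n, ∫ ω, X 0 ω * X (i + 1) ω ∂μ) := by
  have hi : ∀ i, Integrable (fun ω ↦ X i ω * X n ω) μ := fun i ↦ (hX i).integrable_mul (hX n)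
  have e : ∀ ω, partialSum X (n + 1) ω ^ 2 = partialSum X n ω ^ 2 +
      (X n ω * X n ω + 2 * ∑ i ∈ Finset.range n, X i ω * X n ω) := fun ω ↦ by
    rw [partialSum, Finset.sum_range_succ, ← partialSum, ← Finset.sum_mul, ← partialSum]
    ring
  have hsum := integrable_finsetSum (Finset.range n) fun i _ ↦ hi i
  simp_rw [e]
  have e1 := integral_add (memLp_partialSum hX n).integrable_sq ((hi n).add (hsum.const_mul 2))
  simp only [Pi.add_apply] at e1
  rw [e1, integral_add (hi n) (hsum.const_mul 2), integral_const_mul,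
    integral_finsetSum _ fun i _ ↦ hi i, ← Finset.sum_range_reflect]
  congr 2
  · simpa using hstat.integral_mul_eq n 0
  · congr 1
    refine Finset.sum_congr rfl fun i hi ↦ ?_
    have := Finset.mem_range.1 hi
    rw [← hstat.integral_mul_eq (n - 1 - i) (i + 1),
      show i + 1 + (n - 1 - i) = n by omega]

/-- The increments of `E S_n²` are partial sums of an autocovariance series dominated by `γ`, so
they converge; `E S_n² / n` is their Cesàro mean. -/
theorem exists_tendsto_integral_partialSum_sq [IsProbabilityMeasure μ]
    (hγ : IsCovarianceBound μ X γ) (hγ0 : ∀ k, 0 ≤ γ k) (hs : Summable γ)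
    (hX : ∀ n, MemLp (X n) 2 μ) (hcent : ∀ n, ∫ ω, X n ω ∂μ = 0)
    (hstat : IsStrictlyStationary μ X) :
    ∃ v : ℝ≥0, Tendsto (fun n : ℕ ↦ (1 / (n : ℝ)) * ∫ ω, (partialSum X n ω) ^ 2 ∂μ) atTop
      (𝓝 (v : ℝ)) := by
  have hr : Summable fun k ↦ ∫ ω, X 0 ω * X (k + 1) ω ∂μ :=
    Summable.of_norm_bounded ((summable_nat_add_iff 1).2 hs)
      fun k ↦ hγ.abs_integral_mul_le hγ0 hX hcent k
  have ht := ((hr.hasSum.tendsto_sum_nat.const_mul 2).const_add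
    (∫ ω, X 0 ω * X 0 ω ∂μ)).cesaro
  have he : ∀ n : ℕ, ∫ ω, partialSum X n ω ^ 2 ∂μ = ∑ k ∈ Finset.range n,
      (∫ ω, X 0 ω * X 0 ω ∂μ + 2 * ∑ i ∈ Finset.range k, ∫ ω, X 0 ω * X (i + 1) ω ∂μ) := by
    intro n
    induction n with
    | zero => simp [partialSum]
    | succ n ih => rw [integral_partialSum_succ_sq hX hstat, ih, Finset.sum_range_succ]
  simp_rw [← he, ← one_div] at ht
  have h0 := ge_of_tendsto' ht fun n ↦
    mul_nonneg (by positivity) (integral_nonneg fun ω ↦ sq_nonneg (partialSum X n ω))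
  exact ⟨⟨_, h0⟩, ht⟩

/-! ### Limit of powers of one block's characteristic function -/

theorem tendsto_nat_mul_charFun_sub_one [IsProbabilityMeasure μ] {Y : Ω → ℝ} (hY : MemLp Y 2 μ)
    (h0 : ∫ ω, Y ω ∂μ = 0) (t : ℝ) :
    Tendsto (fun n : ℕ ↦ (n : ℂ) *
      (∫ ω, Complex.exp ((t / √n * Y ω : ℝ) * Complex.I) ∂μ - 1)) atTop
      (𝓝 (-((t ^ 2 * ∫ ω, Y ω ^ 2 ∂μ) / 2 : ℝ))) := by
  have hm := hY.aestronglyMeasurable.aemeasurable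
  have : IsProbabilityMeasure (μ.map Y) := Measure.isProbabilityMeasure_map hm
  have hid : MemLp id 2 (μ.map Y) := (memLp_map_measure_iff (by fun_prop) hm).2 hY
  have hT := taylor_isLittleO_univ (x₀ := 0) (n := 2) (contDiff_charFun (n := 2) hid)
  simp only [taylorWithinEval_charFun_two_zero hm hid, sub_zero] at hT
  have hlim : Tendsto (fun n : ℕ ↦ t / √n) atTop (𝓝 0) :=
    tendsto_const_nhds.div_atTop (Real.tendsto_sqrt_atTop.comp tendsto_natCast_atTop_atTop)
  have hO : ((fun x : ℝ ↦ x ^ 2) ∘ fun n : ℕ ↦ t / √n) =O[atTop] fun n : ℕ ↦ (1 / n : ℝ) := by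
    refine Asymptotics.IsBigO.of_bound (t ^ 2) (.of_forall fun n ↦ ?_)
    rw [Function.comp_apply, div_pow, Real.sq_sqrt n.cast_nonneg, div_eq_mul_one_div, norm_mul,
      Real.norm_of_nonneg (sq_nonneg t)]
  -- The second-order Taylor remainder is `o(1 / n)` at `t / √n`, so it survives multiplication by
  -- `n`.
  have hT' := (((hT.comp_tendsto hlim).trans_isBigO hO).tendsto_inv_smul_nhds_zero).add_const
    ((-((t ^ 2 * ∫ ω, Y ω ^ 2 ∂μ) / 2 : ℝ) : ℂ))
  rw [zero_add] at hT'
  refine hT'.congr' ?_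
  filter_upwards [eventually_ne_atTop 0] with n hn
  have hn0 : (n : ℂ) ≠ 0 := by exact_mod_cast hn
  have hsq : ((√n : ℝ) : ℂ) ^ 2 = n := by
    rw [← Complex.ofReal_pow, Real.sq_sqrt n.cast_nonneg, Complex.ofReal_natCast]
  simp only [Function.comp_apply, h0, charFun_apply_real, Pi.pow_apply]
  rw [integral_map hm (by fun_prop)]
  push_cast
  simp only [div_pow, hsq, one_div, inv_inv, Complex.real_smul, Complex.ofReal_natCast]
  generalize ∫ ω, Complex.exp ((t : ℂ) / (√n : ℝ) * Y ω * Complex.I) ∂μ = J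
  field_simp
  ring

theorem tendsto_charFun_pow_div [IsProbabilityMeasure μ] {Y : Ω → ℝ} (hY : MemLp Y 2 μ)
    (h0 : ∫ ω, Y ω ∂μ = 0) (t : ℝ) {m : ℕ} (hm : 0 < m) :
    Tendsto (fun n : ℕ ↦ (∫ ω, Complex.exp ((t / √n * Y ω : ℝ) * Complex.I) ∂μ) ^ (n / m)) atTop
      (𝓝 (Complex.exp (-((t ^ 2 * (1 / (m : ℝ) * ∫ ω, Y ω ^ 2 ∂μ)) / 2 : ℝ)))) := by
  set φ : ℕ → ℂ := fun n ↦ ∫ ω, Complex.exp ((t / √n * Y ω : ℝ) * Complex.I) ∂μ with hφ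
  have h1 := tendsto_nat_mul_charFun_sub_one hY h0 t
  have hlog := Complex.tendsto_nat_mul_log_one_add_of_tendsto h1
  have hk : Tendsto (fun n : ℕ ↦ ((n / m : ℕ) : ℝ) / n) atTop (𝓝 (1 / m)) := by
    refine ((tendsto_nat_floor_mul_div_atTop (R := ℝ) (a := 1 / m) (by positivity)).comp
      tendsto_natCast_atTop_atTop).congr fun n ↦ ?_
    simp only [Function.comp_apply]
    rw [one_div_mul_eq_div, Nat.floor_div_eq_div]
  have hk' : Tendsto (fun n : ℕ ↦ (((n / m : ℕ) : ℂ) / n)) atTop (𝓝 ((1 / m : ℝ) : ℂ)) := by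
    refine ((Complex.continuous_ofReal.tendsto _).comp hk).congr fun n ↦ ?_
    simp
  have hφ1 : Tendsto (fun n ↦ φ n - 1) atTop (𝓝 0) := by
    have h2 := (tendsto_inv_atTop_nhds_zero_nat (𝕜 := ℂ)).mul h1
    rw [zero_mul] at h2
    refine h2.congr' ?_
    filter_upwards [eventually_ne_atTop 0] with n hn
    rw [inv_mul_cancel_left₀ (by exact_mod_cast hn)]
  -- Needed to recover `φ n` from `exp (log (φ n))`.
  have hne : ∀ᶠ n in atTop, φ n ≠ 0 := by
    filter_upwards [hφ1.eventually_ne (show (0 : ℂ) ≠ -1 by simp)] with n hn h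
    simp [h] at hn
  have h3 := (Complex.continuous_exp.tendsto _).comp (hk'.mul hlog)
  have hexp : ((1 / m : ℝ) : ℂ) * -((t ^ 2 * ∫ ω, Y ω ^ 2 ∂μ) / 2 : ℝ) =
      -((t ^ 2 * (1 / (m : ℝ) * ∫ ω, Y ω ^ 2 ∂μ)) / 2 : ℝ) := by
    push_cast
    ring
  rw [hexp] at h3
  refine h3.congr' ?_
  filter_upwards [hne, eventually_ne_atTop 0] with n hn hn0
  have hn0' : (n : ℂ) ≠ 0 := by exact_mod_cast hn0
  simp only [Function.comp_apply, add_sub_cancel]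
  rw [← mul_assoc, div_mul_cancel₀ _ hn0', Complex.exp_nat_mul, Complex.exp_log hn]

/-! ### Leftover terms and conclusion -/

theorem norm_integral_cexp_sub_integral_cexp_le [IsProbabilityMeasure μ] {U V : Ω → ℝ}
    (hU : Integrable U μ) (hV : Integrable V μ) :
    ‖∫ ω, Complex.exp (U ω * Complex.I) ∂μ - ∫ ω, Complex.exp (V ω * Complex.I) ∂μ‖ ≤
      ∫ ω, |U ω - V ω| ∂μ := by
  have hi : ∀ {U : Ω → ℝ}, Integrable U μ →
      Integrable (fun ω ↦ Complex.exp (U ω * Complex.I)) μ := fun {U} hU ↦ by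
    have := hU.aestronglyMeasurable.aemeasurable
    exact Integrable.of_bound (by fun_prop) 1
      (.of_forall fun ω ↦ (Complex.norm_exp_ofReal_mul_I _).le)
  rw [← integral_sub (hi hU) (hi hV)]
  refine norm_integral_le_of_norm_le (hU.sub hV).abs (.of_forall fun ω ↦ ?_)
  have e : Complex.exp (U ω * Complex.I) - Complex.exp (V ω * Complex.I) =
      (Complex.exp (Complex.I * (U ω - V ω : ℝ)) - 1) * Complex.exp (V ω * Complex.I) := by
    rw [sub_mul, one_mul, ← Complex.exp_add]
    congr 2
    push_cast
    ring
  rw [e, norm_mul, Complex.norm_exp_ofReal_mul_I, mul_one]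
  exact Real.norm_exp_I_mul_ofReal_sub_one_le

theorem norm_integral_cexp_partialSum_sub_le [IsProbabilityMeasure μ]
    (hX : ∀ n, MemLp (X n) 2 μ) (hstat : IsStrictlyStationary μ X) (s : ℝ) (m r : ℕ) :
    ‖∫ ω, Complex.exp ((s * partialSum X (m + r) ω : ℝ) * Complex.I) ∂μ -
      ∫ ω, Complex.exp ((s * partialSum X m ω : ℝ) * Complex.I) ∂μ‖ ≤
      |s| * (r * ∫ ω, |X 0 ω| ∂μ) := by
  have hi : ∀ n, Integrable (partialSum X n) μ := fun n ↦
    (memLp_partialSum hX n).integrable one_le_two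
  have hXi : ∀ n, Integrable (fun ω ↦ |X n ω|) μ := fun n ↦ ((hX n).integrable one_le_two).abs
  have habs : ∀ n, ∫ ω, |X n ω| ∂μ = ∫ ω, |X 0 ω| ∂μ := fun n ↦ by
    have := ((hstat n {0}).comp (u := fun x : ({0} : Finset ℕ) → ℝ ↦ |x ⟨0, by simp⟩|) (by fun_prop)).integral_eq
    simpa [Function.comp_def] using this
  refine (norm_integral_cexp_sub_integral_cexp_le ((hi _).const_mul s)
    ((hi _).const_mul s)).trans ?_
  have hle : ∀ ω, |s * partialSum X (m + r) ω - s * partialSum X m ω| ≤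
      |s| * ∑ i ∈ Finset.range r, |X (m + i) ω| := fun ω ↦ by
    rw [← mul_sub, abs_mul, partialSum, partialSum, Finset.sum_range_add, add_sub_cancel_left]
    gcongr
    exact Finset.abs_sum_le_sum_abs _ _
  refine (integral_mono (((hi _).const_mul s).sub ((hi _).const_mul s)).abs
    ((integrable_finsetSum _ fun i _ ↦ hXi (m + i)).const_mul |s|) hle).trans (le_of_eq ?_)
  rw [integral_const_mul, integral_finsetSum _ fun i _ ↦ hXi (m + i)]
  simp [habs]

theorem tendsto_integral_cexp_partialSum [IsProbabilityMeasure μ]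
    (hγ : IsCovarianceBound μ X γ) (hγ0 : ∀ k, 0 ≤ γ k) (hs : Summable γ)
    (hX : ∀ n, MemLp (X n) 2 μ) (hcent : ∀ n, ∫ ω, X n ω ∂μ = 0)
    (hstat : IsStrictlyStationary μ X) {v : ℝ}
    (hv : Tendsto (fun n : ℕ ↦ (1 / (n : ℝ)) * ∫ ω, (partialSum X n ω) ^ 2 ∂μ) atTop (𝓝 v))
    (t : ℝ) :
    Tendsto (fun n : ℕ ↦ ∫ ω, Complex.exp ((t / √n * partialSum X n ω : ℝ) * Complex.I) ∂μ) atTop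
      (𝓝 (Complex.exp (-((t ^ 2 * v) / 2 : ℝ)))) := by
  set ε : ℕ → ℝ := fun m ↦ (m : ℝ)⁻¹ * ∑ j ∈ Finset.range m, ∑' k, γ (k + (j + 1)) with hε
  have hε0 : Tendsto ε atTop (𝓝 0) :=
    ((tendsto_sum_nat_add γ).comp (tendsto_add_atTop_nat 1)).cesaro
  set L : ℝ → ℂ := fun v ↦ Complex.exp (-((t ^ 2 * v) / 2 : ℝ)) with hL
  have hLc : Continuous L := by fun_prop
  have hLm := ((hLc.tendsto v).comp hv).sub_const (L v)
  rw [sub_self] at hLm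
  have h1 : Tendsto (fun m : ℕ ↦ 4 * t ^ 2 * ε m +
      ‖L (1 / (m : ℝ) * ∫ ω, (partialSum X m ω) ^ 2 ∂μ) - L v‖) atTop (𝓝 0) := by
    simpa using (hε0.const_mul (4 * t ^ 2)).add hLm.norm
  have hc0 : ∀ m, ∫ ω, partialSum X m ω ∂μ = 0 := fun m ↦ by
    simp only [partialSum]
    rw [integral_finsetSum _ fun i _ ↦ (hX i).integrable one_le_two]
    simp [hcent]
  rw [Metric.tendsto_atTop']
  intro δ hδ
  -- The block length is fixed before `n`: it controls the factorisation error and the variance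
  -- error, both uniform in `n`.
  obtain ⟨m, hmδ, hm⟩ :=
    ((h1.eventually_lt_const (half_pos hδ)).and (eventually_gt_atTop 0)).exists
  have hpow := tendsto_charFun_pow_div (memLp_partialSum hX m) (hc0 m) t hm
  have hrem : Tendsto (fun n : ℕ ↦ |t / √n| * (m * ∫ ω, |X 0 ω| ∂μ)) atTop (𝓝 0) := by
    have hlim : Tendsto (fun n : ℕ ↦ t / √n) atTop (𝓝 0) :=
      tendsto_const_nhds.div_atTop (Real.tendsto_sqrt_atTop.comp tendsto_natCast_atTop_atTop)
    simpa using hlim.abs.mul_const (m * ∫ ω, |X 0 ω| ∂μ)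
  have h2 := hrem.add (hpow.sub_const
    (L (1 / (m : ℝ) * ∫ ω, (partialSum X m ω) ^ 2 ∂μ))).norm
  rw [sub_self, norm_zero, add_zero] at h2
  obtain ⟨N, hN⟩ := eventually_atTop.1 (h2.eventually_lt_const (half_pos hδ))
  refine ⟨N, fun n hn ↦ ?_⟩
  have hb := hN n hn.le
  have hn0 : 0 < (n : ℝ) := by exact_mod_cast (Nat.zero_le N).trans_lt hn
  have hA := norm_integral_cexp_partialSum_sub_pow_le hγ hγ0 hs
    (fun n ↦ (hX n).aestronglyMeasurable.aemeasurable) hstat (t / √n) m (n / m)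
  have hR := norm_integral_cexp_partialSum_sub_le hX hstat (t / √n) (n / m * m) (n % m)
  rw [Nat.div_add_mod'] at hR
  have hR' := hR.trans (show _ ≤ |t / √n| * (m * ∫ ω, |X 0 ω| ∂μ) by
    gcongr
    exact (Nat.mod_lt n hm).le)
  have hS0 : 0 ≤ ∑ j ∈ Finset.range m, ∑' k, γ (k + (j + 1)) :=
    Finset.sum_nonneg fun _ _ ↦ tsum_nonneg fun _ ↦ hγ0 _
  have hA' := hA.trans (show _ ≤ 4 * t ^ 2 * ε m by
    have hkm : ((n / m : ℕ) : ℝ) / n ≤ (m : ℝ)⁻¹ := by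
      rw [div_le_iff₀ hn0, inv_mul_eq_div]
      exact Nat.cast_div_le
    rw [div_pow, Real.sq_sqrt hn0.le]
    calc _ = (4 * t ^ 2) * (((n / m : ℕ) : ℝ) / n *
          ∑ j ∈ Finset.range m, ∑' k, γ (k + (j + 1))) := by ring
      _ ≤ _ := mul_le_mul_of_nonneg_left (mul_le_mul_of_nonneg_right hkm hS0) (by positivity))
  rw [dist_eq_norm]
  set a := ∫ ω, Complex.exp ((t / √n * partialSum X n ω : ℝ) * Complex.I) ∂μ
  set b := ∫ ω, Complex.exp ((t / √n * partialSum X (n / m * m) ω : ℝ) * Complex.I) ∂μ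
  set c := (∫ ω, Complex.exp ((t / √n * partialSum X m ω : ℝ) * Complex.I) ∂μ) ^ (n / m)
  set d := L (1 / (m : ℝ) * ∫ ω, (partialSum X m ω) ^ 2 ∂μ)
  -- The four differences are, in order: leftover terms, factorisation, block limit at fixed `m`,
  -- variance.
  have e : a - L v = (a - b) + (b - c) + (c - d) + (d - L v) := by ring
  change ‖a - L v‖ < δ
  rw [e]
  have n1 := norm_add_le ((a - b) + (b - c) + (c - d)) (d - L v)
  have n2 := norm_add_le ((a - b) + (b - c)) (c - d)
  have n3 := norm_add_le (a - b) (b - c)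
  linarith

end

theorem mainTheorem4 {Ω : Type*} [MeasurableSpace Ω] (μ : Measure Ω) [IsProbabilityMeasure μ]
    (X : ℕ → Ω → ℝ)
    (hsq : ∀ n, MemLp (X n) 2 μ)
    (hcent : ∀ n, ∫ ω, X n ω ∂μ = 0)
    (hstat : IsStrictlyStationary μ X)
    (hdep : IsLWeaklyDependent μ X) :
    ∃ σ2 : ℝ≥0,
      Tendsto (fun n : ℕ ↦ (1 / (n : ℝ)) * ∫ ω, (partialSum X n ω) ^ 2 ∂μ) atTop (𝓝 (σ2 : ℝ)) ∧
      TendstoInDistribution (fun (n : ℕ) (ω : Ω) ↦ (1 / Real.sqrt (n : ℝ)) * partialSum X n ω)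
        atTop (id : ℝ → ℝ) (fun _ ↦ μ) (gaussianReal 0 σ2) := by
  obtain ⟨γ, hγ0, hs, hγ⟩ := hdep
  obtain ⟨v, hv⟩ := exists_tendsto_integral_partialSum_sq hγ hγ0 hs hsq hcent hstat
  have hm : ∀ n : ℕ, AEMeasurable (fun ω ↦ (1 / √(n : ℝ)) * partialSum X n ω) μ := fun n ↦
    (memLp_partialSum hsq n).aestronglyMeasurable.aemeasurable.const_mul _
  refine ⟨v, hv, hm, aemeasurable_id, ?_⟩
  refine ProbabilityMeasure.tendsto_iff_tendsto_charFun.2 fun t ↦ ?_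
  simp only [ProbabilityMeasure.coe_mk, Measure.map_id, charFun_gaussianReal]
  convert tendsto_integral_cexp_partialSum hγ hγ0 hs hsq hcent hstat hv t using 2 with n
  · rw [charFun_apply_real, integral_map (hm n) (by fun_prop)]
    congr with ω
    congr 2
    push_cast
    ring
  · congr 1
    push_cast
    ring
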